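/- **Lemma 3.** Let $V\subset\mathbb{C}$ be an open neighborhood of $0$ and let $V^+=\{z\in V:\operatorname{Im} z>0\}$. Let $h$ be meromorphic in $V$, let $B$ be holomorphic and zero-free in $V\setminus\{0\}$ with $|B(z)|=1$ for all $z\in V\cap\mathbb{R}\setminus\{0\}$, and let $\varphi$ be univalent (holomorphic and injective) in $V^+$ with $$\varphi'(z)=B(z)\,h(z),\qquad z\in V^+.$$ Then the singularity of $B$ at $0$ is removable, i.e. there is a function holomorphic in $V$ that coincides with $B$ on $V\setminus\{0\}$. -/

import Mathlib

open Metric Set Filter Topology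

/-! Univalence bounds `φ''/φ'` by a constant over `Im z`: a weak Bloch theorem controls the
logarithm of `φ - φ(a)`, whose image cannot contain a disc of radius above `2π`. Integrating along
vertical segments bounds `φ'` and `1/φ'` by powers of `1 / Im z`. Since `h` and `1/h` grow at most
like powers of `1/|z|`, both `B` and `1/B` have such bounds in a upper half-disc. Reflection in the
real axis turns the bound on `1/B` above into a bound on `B` below. Polynomial growth in `1/|Im z|`
excludes an essential singularity (`meromorphicAt_of_norm_mul_abs_im_pow_le`), and `|B| = 1` on the
real axis excludes a pole. -/

/-! ### Covering theorems of Bloch type. -/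

/-- A holomorphic function on a disc whose derivative is at most twice as large as at the centre
covers a disc of definite size. -/
theorem ball_subset_image_ball_of_norm_deriv_le {f : ℂ → ℂ} {a : ℂ} {r : ℝ} (hr : 0 < r)
    (hf : DifferentiableOn ℂ f (ball a r)) (h0 : deriv f a ≠ 0)
    (hb : ∀ z ∈ ball a r, ‖deriv f z‖ ≤ 2 * ‖deriv f a‖) :
    ball (f a) (‖deriv f a‖ * r / 24) ⊆ f '' ball a r := by
  set D := ‖deriv f a‖ with hD
  have hDpos : 0 < D := norm_pos_iff.2 h0
  have hfd : ∀ z ∈ ball a r, DifferentiableAt ℂ f z := fun z hz =>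
    hf.differentiableAt (isOpen_ball.mem_nhds hz)
  have hder : DifferentiableOn ℂ (deriv f) (ball a r) := hf.deriv isOpen_ball
  have hmaps : MapsTo (deriv f) (ball a r) (closedBall (deriv f a) (3 * D)) := by
    intro z hz
    rw [mem_closedBall, dist_eq_norm]
    calc _ ≤ ‖deriv f z‖ + ‖deriv f a‖ := norm_sub_le _ _
      _ ≤ 3 * D := by linarith [hb z hz]
  have hsub : closedBall a (r / 6) ⊆ ball a r := closedBall_subset_ball (by linarith)
  -- Schwarz lemma for `f'`: the radius `r / 6` makes `f'` vary by at most `D / 2`, so on that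
  -- circle the linear part dominates.
  have hlip : ∀ z ∈ closedBall a (r / 6), ‖deriv f z - deriv f a‖ ≤ D / 2 := by
    intro z hz
    have := Complex.dist_le_div_mul_dist_of_mapsTo_ball hder hmaps (hsub hz)
    rw [dist_eq_norm] at this
    refine this.trans ?_
    have hz' : dist z a ≤ r / 6 := hz
    calc 3 * D / r * dist z a ≤ 3 * D / r * (r / 6) := by gcongr
      _ = D / 2 := by field_simp; norm_num
  have hsphere : ∀ z ∈ sphere a (r / 6), D * r / 12 ≤ ‖f z - f a‖ := by
    intro z hz
    have hz' : ‖z - a‖ = r / 6 := by rwa [mem_sphere, dist_eq_norm] at hz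
    have key := (convex_closedBall a (r / 6)).norm_image_sub_le_of_norm_hasDerivWithin_le
      (f := fun w => f w - deriv f a * w) (f' := fun w => deriv f w - deriv f a * 1) (C := D / 2)
      (fun w hw => ((hfd w (hsub hw)).hasDerivAt.sub
        ((hasDerivAt_id w).const_mul _)).hasDerivWithinAt)
      (fun w hw => by simpa using hlip w hw) (mem_closedBall_self (by linarith))
      (sphere_subset_closedBall hz)
    have h1 : ‖deriv f a * (z - a)‖ = D * (r / 6) := by rw [norm_mul, hz']
    have h2 : f z - deriv f a * z - (f a - deriv f a * a)
      = (f z - f a) - deriv f a * (z - a) := by ring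
    rw [h2, hz'] at key
    have h3 := norm_sub_norm_le (deriv f a * (z - a)) (f z - f a)
    rw [norm_sub_rev (deriv f a * (z - a)), h1] at h3
    linarith
  have hne : ∃ᶠ z in 𝓝 a, f z ≠ f a := by
    have h := (hfd a (mem_ball_self hr)).hasDerivAt.eventually_ne (c := f a) h0
    exact h.frequently.filter_mono nhdsWithin_le_nhds
  have hcl : DiffContOnCl ℂ f (ball a (r / 6)) := hf.diffContOnCl_ball hsub
  have := hcl.ball_subset_image_closedBall (by linarith) hsphere hne
  refine Subset.trans (ball_subset_ball ?_) (this.trans (image_mono hsub))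
  linarith

/-- A weak form of **Bloch's theorem**. -/
theorem exists_ball_subset_image_ball {f : ℂ → ℂ} {c : ℂ} {R : ℝ} (hR : 0 < R)
    (hf : DifferentiableOn ℂ f (ball c R)) :
    ∃ w, ball w (‖deriv f c‖ * R / 96) ⊆ f '' ball c R := by
  by_cases h0 : deriv f c = 0
  · exact ⟨0, by simp [h0]⟩
  set ρ := R / 2 with hρ
  have hsub : closedBall c ρ ⊆ ball c R := closedBall_subset_ball (by linarith)
  -- Landau's trick: where this weight is maximal, `|f'|` at most doubles within half the distance
  -- to the circle of radius `ρ`.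
  have hcont : ContinuousOn (fun z => (ρ - dist z c) * ‖deriv f z‖) (closedBall c ρ) :=
    ContinuousOn.mul (by fun_prop) ((hf.deriv isOpen_ball).continuousOn.mono hsub).norm
  obtain ⟨a, ha, hmax⟩ := (isCompact_closedBall c ρ).exists_isMaxOn
    ⟨c, mem_closedBall_self (by linarith)⟩ hcont
  have hc : ρ * ‖deriv f c‖ ≤ (ρ - dist a c) * ‖deriv f a‖ := by
    simpa using hmax (mem_closedBall_self (by linarith) : c ∈ closedBall c ρ)
  have hcpos : 0 < ‖deriv f c‖ := norm_pos_iff.2 h0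
  have hpos : 0 < (ρ - dist a c) * ‖deriv f a‖ := lt_of_lt_of_le (by positivity) hc
  have hac : dist a c ≤ ρ := ha
  have ha0 : deriv f a ≠ 0 := by
    rintro h; simp [h] at hpos
  have hapos : 0 < ‖deriv f a‖ := norm_pos_iff.2 ha0
  have hs : 0 < ρ - dist a c := pos_of_mul_pos_left hpos hapos.le
  set s := (ρ - dist a c) / 2 with hsdef
  have hsub' : ball a s ⊆ closedBall c ρ := by
    intro z hz
    have : dist z c ≤ dist z a + dist a c := dist_triangle _ _ _
    rw [mem_ball] at hz
    rw [mem_closedBall]; linarith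
  have := ball_subset_image_ball_of_norm_deriv_le (a := a) (r := s) (by linarith)
    (hf.mono (hsub'.trans hsub)) ha0 (by
      intro z hz
      have h1 : (ρ - dist z c) * ‖deriv f z‖ ≤ (ρ - dist a c) * ‖deriv f a‖ := hmax (hsub' hz)
      have h2 : s ≤ ρ - dist z c := by
        have : dist z c ≤ dist z a + dist a c := dist_triangle _ _ _
        rw [mem_ball] at hz
        linarith
      have h3 : s * ‖deriv f z‖ ≤ s * (2 * ‖deriv f a‖) := by
        calc _ ≤ (ρ - dist z c) * ‖deriv f z‖ := by gcongr
          _ ≤ _ := h1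
          _ = _ := by rw [hsdef]; ring
      exact le_of_mul_le_mul_left h3 (by linarith))
  refine ⟨f a, Subset.trans (ball_subset_ball ?_) (this.trans (image_mono (hsub'.trans hsub)))⟩
  have : ‖deriv f c‖ * R / 96 = ρ * ‖deriv f c‖ / 48 := by rw [hρ]; ring
  rw [this]
  have : ‖deriv f a‖ * s / 24 = (ρ - dist a c) * ‖deriv f a‖ / 48 := by rw [hsdef]; ring
  rw [this]
  linarith

/-! ### Distortion estimates for univalent functions on discs. -/

/-- A nonvanishing holomorphic function on a disc has a holomorphic logarithm. -/
theorem exists_exp_eq_on_ball {ψ : ℂ → ℂ} {c : ℂ} {R : ℝ} (hR : 0 < R)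
    (hψ : DifferentiableOn ℂ ψ (ball c R)) (hne : ∀ z ∈ ball c R, ψ z ≠ 0) :
    ∃ g : ℂ → ℂ, DifferentiableOn ℂ g (ball c R) ∧ ∀ z ∈ ball c R, Complex.exp (g z) = ψ z := by
  have hex : Complex.IsExactOn (fun z => deriv ψ z / ψ z) (ball c R) :=
    ((hψ.deriv isOpen_ball).div hψ hne).isExactOn_ball
  obtain ⟨g, hgc, hg⟩ := hex.with_val_at c (Complex.log (ψ c))
  have hcb : c ∈ ball c R := mem_ball_self hR
  refine ⟨g, fun z hz => (hg z hz).differentiableAt.differentiableWithinAt, ?_⟩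
  have hd : ∀ z ∈ ball c R, HasDerivAt (fun z => Complex.exp (-g z) * ψ z) 0 z := by
    intro z hz
    have h1 := (hg z hz).neg.cexp.mul
      (hψ.differentiableAt (isOpen_ball.mem_nhds hz)).hasDerivAt
    refine HasDerivAt.congr_deriv (f' := _) h1 ?_
    have := hne z hz
    field_simp
    ring
  intro z hz
  have key : Complex.exp (-g z) * ψ z = Complex.exp (-g c) * ψ c :=
    (isOpen_ball (x := c) (ε := R)).is_const_of_deriv_eq_zero (convex_ball c R).isPreconnected
      (f := fun z => Complex.exp (-g z) * ψ z)
      (fun w hw => (hd w hw).differentiableAt.differentiableWithinAt)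
      (fun w hw => (hd w hw).deriv) hz hcb
  rw [hgc, Complex.exp_neg (Complex.log _), Complex.exp_log (hne c hcb),
    inv_mul_cancel₀ (hne c hcb), Complex.exp_neg] at key
  rw [inv_mul_eq_one₀ (Complex.exp_ne_zero _)] at key
  exact key

/-- The logarithm of a univalent function on a disc has derivative controlled by the distance
to the boundary. -/
theorem norm_deriv_mul_le_of_injOn_exp {g : ℂ → ℂ} {c : ℂ} {R : ℝ} (hR : 0 < R)
    (hg : DifferentiableOn ℂ g (ball c R)) (hinj : InjOn (fun z => Complex.exp (g z)) (ball c R)) :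
    ‖deriv g c‖ * R ≤ 768 := by
  by_contra! hlt
  obtain ⟨w, hw⟩ := exists_ball_subset_image_ball hR hg
  -- Since `768 = 8 * 96`, the covered disc has radius above `8 > 2π`, so it contains two points
  -- with the same exponential.
  have hpos : (0 : ℝ) < ‖deriv g c‖ * R / 96 := by linarith
  obtain ⟨x, hx, hxw⟩ := hw (mem_ball_self hpos)
  have hmem : w + 2 * Real.pi * Complex.I ∈ ball w (‖deriv g c‖ * R / 96) := by
    rw [mem_ball, dist_eq_norm, add_sub_cancel_left]
    have : ‖(2 * Real.pi * Complex.I : ℂ)‖ = 2 * Real.pi := by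
      simp [Real.pi_pos.le]
    rw [this]
    linarith [Real.pi_lt_four]
  obtain ⟨y, hy, hyw⟩ := hw hmem
  have : x = y := hinj hx hy (by simp only [hxw, hyw, Complex.exp_periodic w])
  rw [← this, hxw] at hyw
  have h2 : (2 * Real.pi * Complex.I : ℂ) = 0 := by simpa using hyw.symm
  exact Complex.two_pi_I_ne_zero h2

/-- Minimum principle: a univalent function on a disc takes, on each smaller circle, a value
not farther from the central one than the linearisation predicts. -/
theorem exists_mem_sphere_norm_sub_le {f : ℂ → ℂ} {c : ℂ} {R ρ : ℝ} (hρ : 0 < ρ) (hρR : ρ < R)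
    (hf : DifferentiableOn ℂ f (ball c R)) (hinj : InjOn f (ball c R)) (h0 : deriv f c ≠ 0) :
    ∃ a ∈ sphere c ρ, ‖f a - f c‖ ≤ ρ * ‖deriv f c‖ := by
  have hcb : ball c R ∈ 𝓝 c := ball_mem_nhds c (hρ.trans hρR)
  have hsub : closedBall c ρ ⊆ ball c R := closedBall_subset_ball hρR
  have hds : DifferentiableOn ℂ (dslope f c) (ball c R) :=
    (Complex.differentiableOn_dslope hcb).2 hf
  have hne : ∀ z ∈ ball c R, dslope f c z ≠ 0 := by
    intro z hz
    rcases eq_or_ne z c with rfl | hzc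
    · simpa using h0
    · rw [dslope_of_ne _ hzc, slope_def_field]
      exact div_ne_zero (sub_ne_zero.2 fun h => hzc (hinj hz (mem_of_mem_nhds hcb) h))
        (sub_ne_zero.2 hzc)
  obtain ⟨a, ha, hmin⟩ := (isCompact_sphere c ρ).exists_isMinOn
    (NormedSpace.sphere_nonempty.2 hρ.le)
    (hds.continuousOn.norm.mono (sphere_subset_closedBall.trans hsub))
  have hab : a ∈ ball c R := hsub (sphere_subset_closedBall ha)
  refine ⟨a, ha, ?_⟩
  -- Injectivity makes the difference quotient zero-free, so the maximum principle applies to its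
  -- reciprocal.
  have hinv : DiffContOnCl ℂ (fun z => (dslope f c z)⁻¹) (ball c ρ) :=
    (hds.inv hne).diffContOnCl_ball hsub
  have h1 := Complex.norm_le_of_forall_mem_frontier_norm_le isBounded_ball hinv
    (C := ‖dslope f c a‖⁻¹) (fun z hz => by
      rw [frontier_ball c hρ.ne'] at hz
      rw [norm_inv]
      exact inv_anti₀ (norm_pos_iff.2 (hne a hab)) (hmin hz))
    (subset_closure (mem_ball_self hρ))
  rw [norm_inv, dslope_same] at h1
  have h2 := (inv_le_inv₀ (norm_pos_iff.2 h0) (norm_pos_iff.2 (hne a hab))).1 h1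
  have hac : a ≠ c := by
    rintro rfl; simp at ha; linarith
  have hac' : ‖a - c‖ = ρ := by rwa [mem_sphere, dist_eq_norm] at ha
  rw [dslope_of_ne _ hac, slope_def_field, norm_div, hac', div_le_iff₀ hρ] at h2
  linarith

/-- A non-sharp form of the classical bound for the pre-Schwarzian of a univalent function. -/
theorem norm_deriv_deriv_mul_le_of_injOn {f : ℂ → ℂ} {c : ℂ} {R : ℝ} (hR : 0 < R)
    (hf : DifferentiableOn ℂ f (ball c R)) (hinj : InjOn f (ball c R)) (h0 : deriv f c ≠ 0) :
    ‖deriv (deriv f) c‖ * R ≤ 9216 * ‖deriv f c‖ := by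
  set ρ := R / 2 with hρdef
  have hρ : 0 < ρ := by linarith
  have hsub : ball c ρ ⊆ ball c R := ball_subset_ball (by linarith)
  -- The omitted value `f a` is taken on the boundary circle, so `f - f a` has a logarithm `g`
  -- inside, while `|f c - f a|` stays comparable to `ρ |f' c|`.
  obtain ⟨a, ha, hfa⟩ := exists_mem_sphere_norm_sub_le hρ (by linarith : ρ < R) hf hinj h0
  have haR : a ∈ ball c R := by
    rw [mem_sphere] at ha; rw [mem_ball]; linarith
  have hψ : DifferentiableOn ℂ (fun z => f z - f a) (ball c ρ) := (hf.mono hsub).sub_const _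
  have hψne : ∀ z ∈ ball c ρ, f z - f a ≠ 0 := by
    intro z hz h
    have := hinj (hsub hz) haR (sub_eq_zero.1 h)
    rw [mem_ball, this, mem_sphere.1 ha] at hz
    exact lt_irrefl _ hz
  obtain ⟨g, hg, hexp⟩ := exists_exp_eq_on_ball hρ hψ hψne
  have hginj : InjOn (fun z => Complex.exp (g z)) (ball c ρ) := by
    intro x hx y hy hxy
    simp only [hexp x hx, hexp y hy, sub_left_inj] at hxy
    exact hinj (hsub hx) (hsub hy) hxy
  have hgb : ∀ z ∈ closedBall c (ρ / 2), ‖deriv g z‖ ≤ 1536 / ρ := by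
    intro z hz
    have hs : ball z (ρ / 2) ⊆ ball c ρ := by
      intro w hw
      have := dist_triangle w z c
      rw [mem_ball] at *; rw [mem_closedBall] at hz; linarith
    have := norm_deriv_mul_le_of_injOn_exp (half_pos hρ) (hg.mono hs) (hginj.mono hs)
    rw [le_div_iff₀ hρ]; linarith
  have hg' : DifferentiableOn ℂ (deriv g) (ball c ρ) := hg.deriv isOpen_ball
  have hg2 : ‖deriv (deriv g) c‖ ≤ 1536 / ρ / (ρ / 2) :=
    Complex.norm_deriv_le_of_forall_mem_sphere_norm_le (half_pos hρ)
      (hg'.diffContOnCl_ball (closedBall_subset_ball (by linarith)))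
      fun z hz => hgb z (sphere_subset_closedBall hz)
  have hg1 : ‖deriv g c‖ ≤ 1536 / ρ := hgb c (mem_closedBall_self (by linarith))
  have hcρ : c ∈ ball c ρ := mem_ball_self hρ
  have hfd : ∀ z ∈ ball c ρ, deriv f z = deriv g z * (f z - f a) := by
    intro z hz
    have h1 := (hg.differentiableAt (isOpen_ball.mem_nhds hz)).hasDerivAt.cexp
    have h2 : (fun z => Complex.exp (g z)) =ᶠ[𝓝 z] fun z => f z - f a :=
      eventually_of_mem (isOpen_ball.mem_nhds hz) hexp
    have h3 := (h1.congr_of_eventuallyEq h2.symm).deriv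
    rw [deriv_sub_const, hexp z hz] at h3
    rw [h3, mul_comm]
  have hff : deriv (deriv f) c = deriv (deriv g) c * (f c - f a) + deriv g c * deriv f c := by
    have h2 : deriv f =ᶠ[𝓝 c] fun z => deriv g z * (f z - f a) :=
      eventually_of_mem (isOpen_ball.mem_nhds hcρ) hfd
    rw [h2.deriv_eq]
    exact ((hg'.differentiableAt (isOpen_ball.mem_nhds hcρ)).hasDerivAt.mul
      ((hf.differentiableAt (isOpen_ball.mem_nhds (hsub hcρ))).hasDerivAt.sub_const _)).deriv
  rw [hff]
  rw [norm_sub_rev] at hfa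
  have hRρ : R = 2 * ρ := by rw [hρdef]; ring
  calc _ ≤ (‖deriv (deriv g) c‖ * ‖f c - f a‖ + ‖deriv g c‖ * ‖deriv f c‖) * R := by
        gcongr
        exact (norm_add_le _ _).trans (by rw [norm_mul, norm_mul])
    _ ≤ (1536 / ρ / (ρ / 2) * (ρ * ‖deriv f c‖) + 1536 / ρ * ‖deriv f c‖) * R := by gcongr
    _ = 9216 * ‖deriv f c‖ := by rw [hRρ]; field_simp; ring

/-! ### Polynomial growth in the half-disc. -/

/-- A holomorphic function on a half-disc whose logarithmic derivative is at most `n / Im z`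
grows at most like `(Im z)⁻ⁿ`. -/
theorem exists_norm_mul_im_pow_le {G : ℂ → ℂ} {R : ℝ} {n : ℕ} (hR : 0 < R)
    (hG : DifferentiableOn ℂ G {z | ‖z‖ < R ∧ 0 < z.im})
    (hb : ∀ z : ℂ, ‖z‖ < R → 0 < z.im → ‖deriv G z‖ * z.im ≤ n * ‖G z‖) :
    ∃ C, ∀ z : ℂ, ‖z‖ < R / 4 → 0 < z.im → ‖G z‖ * z.im ^ n ≤ C := by
  have hopen : IsOpen {z : ℂ | ‖z‖ < R ∧ 0 < z.im} :=
    (isOpen_lt continuous_norm continuous_const).inter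
      (isOpen_lt continuous_const Complex.continuous_im)
  set y₀ := R / 4 with hy₀
  have hy₀pos : 0 < y₀ := by positivity
  have hnorm : ∀ x y : ℝ, |x| ≤ y₀ → 0 < y → y ≤ y₀ → ‖(x + y * Complex.I : ℂ)‖ < R := by
    intro x y hx hy hy'
    calc _ ≤ ‖(x : ℂ)‖ + ‖(y * Complex.I : ℂ)‖ := norm_add_le _ _
      _ = |x| + y := by simp [abs_of_pos hy]
      _ < R := by linarith
  have hcont : ContinuousOn (fun x : ℝ => G (x + y₀ * Complex.I)) (Icc (-y₀) y₀) :=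
    hG.continuousOn.comp (by fun_prop) fun x hx =>
      ⟨hnorm x y₀ (abs_le.2 hx) hy₀pos le_rfl, by simpa using hy₀pos⟩
  obtain ⟨M, hM⟩ := isCompact_Icc.exists_bound_of_continuousOn hcont
  refine ⟨M * y₀ ^ n, fun z hz hzim => ?_⟩
  have hx : |z.re| ≤ y₀ := (Complex.abs_re_le_norm z).trans hz.le
  have hy : z.im ≤ y₀ := (Complex.im_le_norm z).trans hz.le
  set S := Real.log (y₀ / z.im) with hS
  have hS0 : 0 ≤ S := Real.log_nonneg ((one_le_div hzim).2 hy)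
  have hexpS : Real.exp S = y₀ / z.im := Real.exp_log (by positivity)
  -- Exponential parametrisation of the vertical descent to `z`: the hypothesis becomes `|d/ds G(p
  -- s)| ≤ n |G(p s)|`, ready for Grönwall.
  set p : ℝ → ℂ := fun s => z.re + (y₀ * Real.exp (-s) : ℝ) * Complex.I with hp
  have him : ∀ s, (p s).im = y₀ * Real.exp (-s) := fun s => by
    simp only [hp]; simp [-Complex.ofReal_exp, -Complex.ofReal_mul]
  have hpR : ∀ s, 0 ≤ s → ‖p s‖ < R ∧ 0 < (p s).im := by
    intro s hs
    have h1 : Real.exp (-s) ≤ 1 := Real.exp_le_one_iff.2 (by linarith)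
    refine ⟨hnorm _ _ hx (by positivity) ?_, by rw [him]; positivity⟩
    exact mul_le_of_le_one_right hy₀pos.le h1
  have hpd : ∀ s, HasDerivAt p ((-(y₀ * Real.exp (-s)) : ℝ) * Complex.I) s := by
    intro s
    have h1 : HasDerivAt (fun s => y₀ * Real.exp (-s)) (-(y₀ * Real.exp (-s))) s := by
      have := ((hasDerivAt_neg s).exp).const_mul y₀
      simpa using this
    exact (h1.ofReal_comp.mul_const Complex.I).const_add _
  have hFd : ∀ s, 0 ≤ s → HasDerivAt (fun s => G (p s))
      (deriv G (p s) * ((-(y₀ * Real.exp (-s)) : ℝ) * Complex.I)) s := by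
    intro s hs
    exact (hG.differentiableAt (hopen.mem_nhds (hpR s hs))).hasDerivAt.comp_of_eq s (hpd s) rfl
  have key := norm_le_gronwallBound_of_norm_deriv_right_le
    (f := fun s => G (p s)) (f' := fun s => deriv G (p s) *
      ((-(y₀ * Real.exp (-s)) : ℝ) * Complex.I)) (δ := M) (K := n) (ε := 0) (a := 0) (b := S)
    (fun s hs => (hFd s hs.1).continuousAt.continuousWithinAt)
    (fun s hs => (hFd s hs.1).hasDerivWithinAt)
    (by simpa [hp] using hM z.re (abs_le.1 hx))
    (by
      intro s hs
      have h1 := hb (p s) (hpR s hs.1).1 (hpR s hs.1).2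
      rw [him] at h1
      rw [norm_mul, norm_mul, Complex.norm_real, norm_neg, Complex.norm_I, mul_one, add_zero,
        Real.norm_of_nonneg (by positivity)]
      exact h1) S ⟨hS0, le_rfl⟩
  have hpS : p S = z := by
    have : y₀ * Real.exp (-S) = z.im := by
      rw [Real.exp_neg, hexpS]; field_simp
    simp only [hp, this, Complex.re_add_im]
  rw [hpS, gronwallBound_ε0, sub_zero, mul_comm (n : ℝ) S, Real.exp_mul, hexpS,
    Real.rpow_natCast, div_pow, ← mul_div_assoc, le_div_iff₀ (by positivity)] at key
  exact key

/-- Polynomial upper and lower bounds for the derivative of a univalent function on a half-disc. -/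
theorem exists_norm_deriv_bounds_of_injOn {φ : ℂ → ℂ} {R : ℝ} (hR : 0 < R)
    (hφ : DifferentiableOn ℂ φ {z | ‖z‖ < R ∧ 0 < z.im})
    (hinj : InjOn φ {z | ‖z‖ < R ∧ 0 < z.im})
    (hne : ∀ z : ℂ, ‖z‖ < R → 0 < z.im → deriv φ z ≠ 0) :
    ∃ (n : ℕ) (C : ℝ), ∀ z : ℂ, ‖z‖ < R / 8 → 0 < z.im →
      ‖deriv φ z‖ * z.im ^ n ≤ C ∧ ‖(deriv φ z)⁻¹‖ * z.im ^ n ≤ C := by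
  have hopen : IsOpen {z : ℂ | ‖z‖ < R ∧ 0 < z.im} :=
    (isOpen_lt continuous_norm continuous_const).inter
      (isOpen_lt continuous_const Complex.continuous_im)
  have hd : DifferentiableOn ℂ (deriv φ) {z | ‖z‖ < R ∧ 0 < z.im} := hφ.deriv hopen
  have hmono : {z : ℂ | ‖z‖ < R / 2 ∧ 0 < z.im} ⊆ {z : ℂ | ‖z‖ < R ∧ 0 < z.im} :=
    fun z hz => ⟨hz.1.trans (by linarith), hz.2⟩
  have hbound : ∀ z : ℂ, ‖z‖ < R / 2 → 0 < z.im →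
      ‖deriv (deriv φ) z‖ * z.im ≤ (9216 : ℕ) * ‖deriv φ z‖ := by
    intro z hz hzim
    have hsub : ball z z.im ⊆ {z : ℂ | ‖z‖ < R ∧ 0 < z.im} := by
      intro w hw
      rw [mem_ball, dist_eq_norm] at hw
      have h1 : ‖w‖ ≤ ‖z‖ + ‖w - z‖ := by
        simpa using norm_add_le z (w - z)
      have h2 := Complex.abs_im_le_norm (w - z)
      rw [Complex.sub_im] at h2
      have h3 := neg_abs_le (w.im - z.im)
      have h4 := Complex.im_le_norm z
      exact ⟨by linarith, by linarith⟩
    exact_mod_cast norm_deriv_deriv_mul_le_of_injOn hzim (hφ.mono hsub) (hinj.mono hsub)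
      (hne z (hz.trans (by linarith)) hzim)
  obtain ⟨C₁, h₁⟩ := exists_norm_mul_im_pow_le (half_pos hR) (hd.mono hmono) hbound
  obtain ⟨C₂, h₂⟩ := exists_norm_mul_im_pow_le (G := fun z => (deriv φ z)⁻¹) (n := 9216)
    (half_pos hR) ((hd.mono hmono).inv fun z hz => hne z (hmono hz).1 hz.2) (by
      intro z hz hzim
      have hz' := hmono ⟨hz, hzim⟩
      have hnz := hne z hz'.1 hzim
      have hder := ((hd.differentiableAt (hopen.mem_nhds hz')).hasDerivAt.fun_inv hnz).deriv
      have hp : 0 < ‖deriv φ z‖ := norm_pos_iff.2 hnz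
      rw [hder, norm_div, norm_neg, norm_pow, norm_inv]
      have := hbound z hz hzim
      rw [div_mul_eq_mul_div, div_le_iff₀ (by positivity)]
      calc _ ≤ _ := this
        _ = _ := by field_simp)
  refine ⟨9216, max C₁ C₂, fun z hz hzim => ⟨(h₁ z (by linarith) hzim).trans (le_max_left _ _),
    (h₂ z (by linarith) hzim).trans (le_max_right _ _)⟩⟩

/-! ### Excluding an essential singularity. -/

/-- A function holomorphic in a punctured disc, with at most polynomial growth in terms of the
distance to the real axis, is meromorphic at the puncture. -/
theorem meromorphicAt_of_norm_mul_abs_im_pow_le {B : ℂ → ℂ} {R C : ℝ} {n : ℕ} (hR : 0 < R)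
    (hB : DifferentiableOn ℂ B (ball 0 R \ {0}))
    (hC : ∀ z ∈ ball (0 : ℂ) R \ {0}, ‖B z‖ * |z.im| ^ n ≤ C) : MeromorphicAt B 0 := by
  set ρ := R / 2 with hρ
  have hρpos : 0 < ρ := by positivity
  have hsph : sphere (0 : ℂ) ρ ⊆ ball 0 R \ {0} := by
    intro w hw
    rw [mem_sphere_zero_iff_norm] at hw
    refine ⟨by rw [mem_ball_zero_iff]; linarith, ?_⟩
    rintro rfl
    simp at hw; linarith
  obtain ⟨M, hM⟩ := (isCompact_sphere (0 : ℂ) ρ).exists_bound_of_continuousOn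
    (hB.continuousOn.mono hsph)
  set K := max (M * (2 * ρ ^ 2) ^ n) (C * (2 * ρ) ^ n) with hK
  -- On `|w| = r` one has `|w² - r²| = 2r |Im w|`, which cancels the blow-up at the real axis. As
  -- `K` does not depend on `r`, letting `r → 0` bounds `B z * z ^ (2 * n)`.
  have hann : ∀ r, 0 < r → r < ρ → ∀ z : ℂ, r < ‖z‖ → ‖z‖ < ρ →
      ‖B z * (z ^ 2 - r ^ 2) ^ n‖ ≤ K := by
    intro r hr hrρ z hrz hzρ
    set A : Set ℂ := ball 0 ρ \ closedBall 0 r with hA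
    have hclA : closure A ⊆ closedBall 0 ρ ∩ (ball 0 r)ᶜ := by
      refine closure_minimal (fun w hw => ⟨ball_subset_closedBall hw.1, fun h =>
        hw.2 (ball_subset_closedBall h)⟩) (isClosed_closedBall.inter isOpen_ball.isClosed_compl)
    have hopenA : IsOpen A := isOpen_ball.sdiff isClosed_closedBall
    have hsubA : closure A ⊆ ball 0 R \ {0} := by
      intro w hw
      have h := hclA hw
      refine ⟨closedBall_subset_ball (by linarith) h.1, ?_⟩
      rintro rfl
      exact h.2 (mem_ball_self hr)
    have hdiff : DiffContOnCl ℂ (fun w => B w * (w ^ 2 - r ^ 2) ^ n) A := by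
      refine DifferentiableOn.diffContOnCl ((hB.mono hsubA).mul ?_)
      exact Differentiable.differentiableOn (by fun_prop)
    refine Complex.norm_le_of_forall_mem_frontier_norm_le
      (isBounded_ball.subset sdiff_subset) hdiff (C := K) (fun w hw => ?_)
      (subset_closure ⟨by simpa using hzρ, by simpa using hrz⟩)
    rw [hopenA.frontier_eq] at hw
    have hw1 := hclA hw.1
    have hwne := hsubA hw.1
    have hwρ : ‖w‖ ≤ ρ := by simpa using hw1.1
    have hwr : r ≤ ‖w‖ := by simpa using hw1.2
    rw [norm_mul, norm_pow]
    rcases hwρ.eq_or_lt with h | h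
    · refine le_trans ?_ (le_max_left _ _)
      have h1 : ‖w ^ 2 - (r : ℂ) ^ 2‖ ≤ 2 * ρ ^ 2 := by
        calc _ ≤ ‖w ^ 2‖ + ‖(r : ℂ) ^ 2‖ := norm_sub_le _ _
          _ = ρ ^ 2 + r ^ 2 := by simp [h]
          _ ≤ 2 * ρ ^ 2 := by nlinarith
      have h2 := hM w (by simpa using h)
      have : 0 ≤ M := (norm_nonneg _).trans h2
      gcongr
    · refine le_trans ?_ (le_max_right _ _)
      have hwr' : ‖w‖ = r := by
        refine le_antisymm ?_ hwr
        by_contra! h'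
        exact hw.2 ⟨by simpa using h, by simpa using h'⟩
      have h1 : ‖w ^ 2 - (r : ℂ) ^ 2‖ = 2 * r * |w.im| := by
        have h3 : w ^ 2 - (r : ℂ) ^ 2 = w * (w - (starRingEnd ℂ) w) := by
          rw [mul_sub, Complex.mul_conj, Complex.normSq_eq_norm_sq, hwr']
          push_cast; ring
        rw [h3, Complex.sub_conj, norm_mul, hwr']
        simp
        ring
      have h2 := hC w hwne
      have : 0 ≤ C := le_trans (by positivity) h2
      rw [h1, mul_pow]
      calc _ = (‖B w‖ * |w.im| ^ n) * (2 * r) ^ n := by ring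
        _ ≤ C * (2 * ρ) ^ n := by gcongr
  have hbd : ∀ z ∈ ball (0 : ℂ) ρ \ {0}, ‖B z * (z ^ 2) ^ n‖ ≤ K := by
    intro z hz
    have hz0 : 0 < ‖z‖ := norm_pos_iff.2 hz.2
    have hlim : Tendsto (fun r : ℝ => ‖B z * (z ^ 2 - (r : ℂ) ^ 2) ^ n‖) (𝓝[>] 0)
        (𝓝 ‖B z * (z ^ 2) ^ n‖) := by
      have : ContinuousAt (fun r : ℝ => ‖B z * (z ^ 2 - (r : ℂ) ^ 2) ^ n‖) 0 := by fun_prop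
      have h := this.tendsto.mono_left (nhdsWithin_le_nhds (s := Ioi 0))
      simpa using h
    refine le_of_tendsto hlim ?_
    have hzρ : ‖z‖ < ρ := by simpa using hz.1
    filter_upwards [Ioo_mem_nhdsGT hz0] with r hr
    exact hann r hr.1 (hr.2.trans hzρ) z hr.2 hzρ
  have hnhds : ball (0 : ℂ) ρ ∈ 𝓝 0 := ball_mem_nhds _ hρpos
  have hsubρ : ball (0 : ℂ) ρ \ {0} ⊆ ball 0 R \ {0} :=
    sdiff_subset_sdiff_left (ball_subset_ball (by linarith))
  have hrem := Complex.differentiableOn_update_limUnder_of_bddAbove (E := ℂ)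
    (f := fun z => B z * (z ^ 2) ^ n) hnhds
    ((hB.mono hsubρ).mul (Differentiable.differentiableOn (by fun_prop)))
    ⟨K, by rintro _ ⟨z, hz, rfl⟩; exact hbd z hz⟩
  have hmer : MeromorphicAt (fun z => B z * (z ^ 2) ^ n) 0 := by
    refine (hrem.analyticAt hnhds).meromorphicAt.congr ?_
    filter_upwards [self_mem_nhdsWithin] with z hz
    exact Function.update_of_ne hz _ _
  have hpow : MeromorphicAt (fun z : ℂ => (z ^ 2) ^ n) 0 := by fun_prop
  refine (hmer.div hpow).congr ?_
  filter_upwards [self_mem_nhdsWithin] with z hz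
  have : z ≠ 0 := hz
  simp [this]

/-! ### Reflection and exclusion of a pole. -/

/-- The exponential maps a convex half-plane onto the punctured disc. This serves the identity
theorem behind the reflection formula. -/
theorem isPreconnected_ball_sdiff_singleton_zero {R : ℝ} (hR : 0 < R) :
    IsPreconnected (ball (0 : ℂ) R \ {0}) := by
  have h : ball (0 : ℂ) R \ {0} = Complex.exp '' {z | z.re < Real.log R} := by
    ext w
    constructor
    · rintro ⟨hw, hw0⟩
      have hw0' : w ≠ 0 := hw0
      refine ⟨Complex.log w, ?_, Complex.exp_log hw0'⟩
      rw [mem_ball_zero_iff] at hw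
      simpa [Complex.log_re] using Real.log_lt_log (norm_pos_iff.2 hw0') hw
    · rintro ⟨z, hz, rfl⟩
      refine ⟨?_, Complex.exp_ne_zero z⟩
      rw [mem_ball_zero_iff, Complex.norm_exp, ← Real.lt_log_iff_exp_lt hR]
      exact hz
  rw [h]
  exact (convex_halfSpace_re_lt _).isPreconnected.image _ Complex.continuous_exp.continuousOn

/-- A function holomorphic in a punctured disc and of modulus one on the real axis satisfies the
Schwarz reflection identity. -/
theorem mul_conj_conj_eq_one {B : ℂ → ℂ} {R : ℝ} (hR : 0 < R)
    (hB : DifferentiableOn ℂ B (ball 0 R \ {0}))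
    (hreal : ∀ x : ℝ, (x : ℂ) ∈ ball (0 : ℂ) R → x ≠ 0 → ‖B x‖ = 1)
    {z : ℂ} (hz : z ∈ ball (0 : ℂ) R \ {0}) :
    B z * (starRingEnd ℂ) (B ((starRingEnd ℂ) z)) = 1 := by
  have hopen : IsOpen (ball (0 : ℂ) R \ {0}) := isOpen_ball.sdiff isClosed_singleton
  have hconj : ∀ w ∈ ball (0 : ℂ) R \ {0}, (starRingEnd ℂ) w ∈ ball (0 : ℂ) R \ {0} := by
    intro w hw
    exact ⟨by simpa using hw.1, by simpa using hw.2⟩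
  have hd : DifferentiableOn ℂ (fun w => B w * (starRingEnd ℂ) (B ((starRingEnd ℂ) w)))
      (ball 0 R \ {0}) := by
    refine hB.mul fun w hw => ?_
    have h := (hB.differentiableAt (hopen.mem_nhds (hconj w hw))).conj_conj
    rw [Complex.conj_conj] at h
    exact h.differentiableWithinAt
  have hx₀ : ((R / 2 : ℝ) : ℂ) ∈ ball (0 : ℂ) R \ {0} := by
    refine ⟨?_, ?_⟩
    · rw [mem_ball_zero_iff, Complex.norm_real, Real.norm_of_nonneg (by linarith)]; linarith
    · have : (R / 2 : ℝ) ≠ 0 := by positivity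
      simpa using this
  -- On the real axis the product is `|B|² = 1`; real points accumulate at `R / 2`, inside the
  -- domain.
  have hfreq : ∃ᶠ w in 𝓝[≠] ((R / 2 : ℝ) : ℂ),
      B w * (starRingEnd ℂ) (B ((starRingEnd ℂ) w)) = 1 := by
    have ht : Tendsto (fun x : ℝ => (x : ℂ)) (𝓝[≠] (R / 2)) (𝓝[≠] ((R / 2 : ℝ) : ℂ)) :=
      Complex.continuous_ofReal.continuousAt.continuousWithinAt.tendsto_nhdsWithin
        fun x hx h => hx (Complex.ofReal_injective h)
    refine ht.frequently (Eventually.frequently ?_)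
    have hev : ∀ᶠ x : ℝ in 𝓝 (R / 2), (x : ℂ) ∈ ball (0 : ℂ) R \ {0} :=
      Complex.continuous_ofReal.continuousAt.eventually_mem (hopen.mem_nhds hx₀)
    filter_upwards [nhdsWithin_le_nhds hev] with x hx
    have hx0 : x ≠ 0 := by
      rintro rfl; exact hx.2 (by simp)
    rw [Complex.conj_ofReal, Complex.mul_conj, Complex.normSq_eq_norm_sq, hreal x hx.1 hx0]
    simp
  exact (hd.analyticOnNhd hopen).eqOn_of_preconnected_of_frequently_eq analyticOnNhd_const
    (isPreconnected_ball_sdiff_singleton_zero hR) hx₀ hfreq hz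

/-- A function holomorphic in a punctured neighbourhood, meromorphic at the puncture and of modulus
one on the real axis extends holomorphically. -/
theorem exists_differentiableOn_extension_of_meromorphicAt {B : ℂ → ℂ} {V : Set ℂ}
    (hV : V ∈ 𝓝 (0 : ℂ)) (hB : DifferentiableOn ℂ B (V \ {0})) (hmer : MeromorphicAt B 0)
    (hreal : ∀ x : ℝ, (x : ℂ) ∈ V → x ≠ 0 → ‖B x‖ = 1) :
    ∃ G : ℂ → ℂ, DifferentiableOn ℂ G V ∧ ∀ z ∈ V \ {0}, G z = B z := by
  -- A pole would force `|B| → ∞` along the real axis.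
  have hord : 0 ≤ meromorphicOrderAt B 0 := by
    by_contra! hneg
    have h1 := tendsto_norm_cobounded_atTop.comp (tendsto_cobounded_of_meromorphicOrderAt_neg hneg)
    have ht : Tendsto (fun x : ℝ => (x : ℂ)) (𝓝[≠] 0) (𝓝[≠] (0 : ℂ)) := by
      have := Complex.continuous_ofReal.continuousAt.continuousWithinAt.tendsto_nhdsWithin
        (x := (0 : ℝ)) (s := {0}ᶜ) (t := {0}ᶜ) fun x hx h => hx (Complex.ofReal_eq_zero.1 h)
      simpa using this
    have h2 := h1.comp ht
    have hev : ∀ᶠ x : ℝ in 𝓝[≠] 0, (x : ℂ) ∈ V :=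
      nhdsWithin_le_nhds (Complex.continuous_ofReal.continuousAt.eventually_mem (by simpa using hV))
    obtain ⟨x, ⟨hx1, hx2⟩, hx3⟩ :=
      ((h2.eventually_gt_atTop 1).and hev |>.and self_mem_nhdsWithin).exists
    have := hreal x hx2 hx3
    simp only [Function.comp_apply] at hx1
    linarith
  obtain ⟨c, hc⟩ := tendsto_nhds_of_meromorphicOrderAt_nonneg hmer hord
  have hbdd : IsBoundedUnder (· ≤ ·) (𝓝[≠] (0 : ℂ)) fun z => ‖B z - B 0‖ :=
    (hc.sub_const (B 0)).norm.isBoundedUnder_le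
  exact ⟨_, Complex.differentiableOn_update_limUnder_of_isLittleO hV hB
    hbdd.isLittleO_sub_self_inv, fun z hz => Function.update_of_ne hz.2 _ _⟩

/-! ### Assembly of the bounds for `B`. -/

/-- A meromorphic function grows at most polynomially near a point. -/
theorem MeromorphicAt.exists_norm_mul_pow_le {h : ℂ → ℂ} (hh : MeromorphicAt h 0) :
    ∃ (k : ℕ) (C : ℝ), ∀ᶠ z in 𝓝[≠] (0 : ℂ), ‖h z‖ * ‖z‖ ^ k ≤ C := by
  obtain ⟨k, hk⟩ := hh
  have := hk.continuousAt.norm.isBoundedUnder_le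
  obtain ⟨C, hC⟩ := this
  refine ⟨k, C, ?_⟩
  filter_upwards [nhdsWithin_le_nhds (eventually_map.1 hC)] with z hz
  simpa [mul_comm] using hz

theorem lemma3 (V : Set ℂ) (hV : IsOpen V) (h0 : (0 : ℂ) ∈ V)
    (h B φ : ℂ → ℂ)
    (hh : MeromorphicOn h V)
    (hB : DifferentiableOn ℂ B (V \ {0}))
    (hB_ne : ∀ z ∈ V \ {0}, B z ≠ 0)
    (hB_real : ∀ x : ℝ, (x : ℂ) ∈ V → x ≠ 0 → ‖B (x : ℂ)‖ = 1)
    (hφ : DifferentiableOn ℂ φ {z | z ∈ V ∧ 0 < z.im})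
    (hφ_inj : Set.InjOn φ {z | z ∈ V ∧ 0 < z.im})
    (hφ_deriv : ∀ z ∈ V, 0 < z.im → deriv φ z = B z * h z) :
    ∃ G : ℂ → ℂ, DifferentiableOn ℂ G V ∧ ∀ z ∈ V \ {0}, G z = B z := by
  have hVn : V ∈ 𝓝 (0 : ℂ) := hV.mem_nhds h0
  have hmer0 : MeromorphicAt h 0 := hh 0 h0
  -- `h` does not vanish near the origin, since otherwise `φ` would be constant on a half-disc.
  have hne : ∀ᶠ z in 𝓝[≠] (0 : ℂ), h z ≠ 0 := by
    rcases hmer0.eventually_eq_zero_or_eventually_ne_zero with hz | hz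
    · exfalso
      obtain ⟨ε, hε, hball⟩ := Metric.mem_nhdsWithin_iff.1 (inter_mem hz (nhdsWithin_le_nhds hVn))
      have hmem : ∀ z : ℂ, ‖z‖ < ε → 0 < z.im → z ∈ V ∧ h z = 0 := by
        intro z hz hzim
        have hz0 : z ≠ 0 := by rintro rfl; simp at hzim
        have := hball ⟨mem_ball_zero_iff.2 hz, hz0⟩
        exact ⟨this.2, this.1⟩
      set U : Set ℂ := ball 0 ε ∩ {z | 0 < z.im} with hU
      have hUo : IsOpen U := isOpen_ball.inter (isOpen_lt continuous_const Complex.continuous_im)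
      have hUV : U ⊆ {z | z ∈ V ∧ 0 < z.im} := fun z hz =>
        ⟨(hmem z (mem_ball_zero_iff.1 hz.1) hz.2).1, hz.2⟩
      have hpt : ∀ t : ℝ, 0 < t → t < ε → (t : ℂ) * Complex.I ∈ U := by
        intro t ht htε
        refine ⟨?_, by simpa using ht⟩
        rw [mem_ball_zero_iff]; simpa [abs_of_pos ht] using htε
      have ha := hpt (ε / 2) (by positivity) (by linarith)
      have hb := hpt (ε / 3) (by positivity) (by linarith)
      have heq := hUo.is_const_of_deriv_eq_zero
        ((convex_ball 0 ε).inter (convex_halfSpace_im_gt 0)).isPreconnected (hφ.mono hUV)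
        (fun z hz => by
          rw [hφ_deriv z (hUV hz).1 hz.2, (hmem z (mem_ball_zero_iff.1 hz.1) hz.2).2]; simp) ha hb
      have h2 := congrArg Complex.im (hφ_inj (hUV ha) (hUV hb) heq)
      simp at h2
      linarith
    · exact hz
  obtain ⟨k, C, hk⟩ := hmer0.exists_norm_mul_pow_le
  obtain ⟨k', C', hk'⟩ := hmer0.inv.exists_norm_mul_pow_le
  have hVne : ∀ᶠ z in 𝓝[≠] (0 : ℂ), z ∈ V := nhdsWithin_le_nhds hVn
  obtain ⟨R, hR, hball⟩ := Metric.mem_nhdsWithin_iff.1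
    ((hVne.and hne).and (hk.and hk'))
  have hloc : ∀ z : ℂ, ‖z‖ < R → z ≠ 0 →
      (z ∈ V ∧ h z ≠ 0) ∧ ‖h z‖ * ‖z‖ ^ k ≤ C ∧ ‖(h z)⁻¹‖ * ‖z‖ ^ k' ≤ C' :=
    fun z hz hz0 => hball ⟨mem_ball_zero_iff.2 hz, hz0⟩
  have him0 : ∀ z : ℂ, 0 < z.im → z ≠ 0 := by
    rintro z hz rfl; simp at hz
  have hsub : {z : ℂ | ‖z‖ < R ∧ 0 < z.im} ⊆ {z | z ∈ V ∧ 0 < z.im} :=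
    fun z hz => ⟨(hloc z hz.1 (him0 z hz.2)).1.1, hz.2⟩
  obtain ⟨n, D, hD⟩ := exists_norm_deriv_bounds_of_injOn hR (hφ.mono hsub) (hφ_inj.mono hsub)
    (fun z hz hzim => by
      obtain ⟨⟨hzV, hhz⟩, -⟩ := hloc z hz (him0 z hzim)
      rw [hφ_deriv z hzV hzim]
      exact mul_ne_zero (hB_ne z ⟨hzV, him0 z hzim⟩) hhz)
  -- With `r ≤ 1`, raising the exponent of `|Im z|` only weakens a bound, so `n + k + k'` serves
  -- both half-discs.
  set r := min (R / 8) 1 with hr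
  have hrpos : 0 < r := by positivity
  have hrR : r ≤ R / 8 := min_le_left _ _
  have hr1 : r ≤ 1 := min_le_right _ _
  have hpun : ball (0 : ℂ) r \ {0} ⊆ V \ {0} := fun z hz =>
    ⟨(hloc z ((mem_ball_zero_iff.1 hz.1).trans_le (by linarith)) hz.2).1.1, hz.2⟩
  have hup : ∀ z : ℂ, ‖z‖ < r → 0 < z.im →
      ‖B z‖ * z.im ^ (n + k') ≤ D * C' ∧ ‖(B z)⁻¹‖ * z.im ^ (n + k) ≤ D * C := by
    intro z hz hzim
    obtain ⟨⟨hzV, hhz⟩, h1, h2⟩ := hloc z (by linarith) (him0 z hzim)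
    obtain ⟨h3, h4⟩ := hD z (by linarith) hzim
    rw [hφ_deriv z hzV hzim] at h3 h4
    have hzn := Complex.im_le_norm z
    have hBz := hB_ne z ⟨hzV, him0 z hzim⟩
    have hD0 : 0 ≤ D := le_trans (by positivity) h3
    have hp : 0 < ‖h z‖ := norm_pos_iff.2 hhz
    have hq : 0 < ‖B z‖ := norm_pos_iff.2 hBz
    constructor
    · calc ‖B z‖ * z.im ^ (n + k') = (‖B z * h z‖ * z.im ^ n) * (‖(h z)⁻¹‖ * z.im ^ k') := by
            rw [norm_mul, norm_inv, pow_add]; field_simp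
        _ ≤ (‖B z * h z‖ * z.im ^ n) * (‖(h z)⁻¹‖ * ‖z‖ ^ k') := by gcongr
        _ ≤ D * C' := by gcongr
    · calc ‖(B z)⁻¹‖ * z.im ^ (n + k) = (‖(B z * h z)⁻¹‖ * z.im ^ n) * (‖h z‖ * z.im ^ k) := by
            rw [norm_inv, norm_inv, norm_mul, pow_add]; field_simp
        _ ≤ (‖(B z * h z)⁻¹‖ * z.im ^ n) * (‖h z‖ * ‖z‖ ^ k) := by gcongr
        _ ≤ D * C := by gcongr
  refine exists_differentiableOn_extension_of_meromorphicAt hVn hB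
    (meromorphicAt_of_norm_mul_abs_im_pow_le (n := n + k + k') (C := max 1 (max (D * C') (D * C)))
      hrpos (hB.mono hpun) ?_) hB_real
  intro z hz
  have hzr : ‖z‖ < r := mem_ball_zero_iff.1 hz.1
  have hle1 : |z.im| ≤ 1 := (Complex.abs_im_le_norm z).trans (hzr.le.trans hr1)
  rcases lt_trichotomy z.im 0 with hneg | hzero | hpos
  -- Below the axis, `|B z|` equals `1 / |B|` at the conjugate point, where the second bound of
  -- `hup` applies.
  · have hrefl := mul_conj_conj_eq_one hrpos (hB.mono hpun)
      (fun x hx hx0 => hB_real x (hpun ⟨hx, by simpa using hx0⟩).1 hx0) hz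
    have hnorm : ‖B z‖ = ‖(B ((starRingEnd ℂ) z))⁻¹‖ := by
      rw [eq_inv_of_mul_eq_one_left hrefl, norm_inv, norm_inv, RCLike.norm_conj]
    have h5 := (hup ((starRingEnd ℂ) z) (by simpa using hzr) (by simpa using hneg)).2
    rw [Complex.conj_im, ← abs_of_neg hneg] at h5
    rw [hnorm]
    refine le_trans ?_ (h5.trans ((le_max_right _ _).trans (le_max_right _ _)))
    gcongr ?_ * ?_
    exact pow_le_pow_of_le_one (abs_nonneg _) hle1 (by omega)
  · have hzre : ((z.re : ℝ) : ℂ) = z := Complex.ext (by simp) (by simp [hzero])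
    have hre0 : z.re ≠ 0 := by
      intro h; exact hz.2 (by rw [← hzre, h]; simp)
    have h6 := hB_real z.re (by rw [hzre]; exact (hpun hz).1) hre0
    rw [hzre] at h6
    rw [h6, one_mul]
    exact (pow_le_one₀ (abs_nonneg _) hle1).trans (le_max_left _ _)
  · have h5 := (hup z hzr hpos).1
    rw [← abs_of_pos hpos] at h5
    refine le_trans ?_ (h5.trans ((le_max_left _ _).trans (le_max_right _ _)))
    gcongr ?_ * ?_
    exact pow_le_pow_of_le_one (abs_nonneg _) hle1 (by omega)
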